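/- **Theorem.** For distinct $p,q\in[n]=\{1,\dots,n\}$ let $s_{(p,q)}\in\mathbb{R}^n$ be the vector with entry $1$ at $p$, entry $-1$ at $q$ and all other entries $0$. An $m\times n$ *selection matrix* is a real matrix each of whose rows is of the form $s_{(p,q)}$ with $p\ne q$. Let $n\ge 2$, let $S_0$ be a given (deterministic) $m\times n$ selection matrix of rank $r_0$ with $1\le r_0\le\min(m,n-2)$, and let $r_0<r\le n-1$. Let $s_1,s_2,\dots$ be independent random vectors, where $s_i=s_{(p_i,q_i)}$ with $p_i$ uniform on $[n]$ and, given $p_i$, $q_i$ uniform on $[n]\setminus\{p_i\}$, the pairs $(p_i,q_i)$, $i\ge1$, being independent. Append the rows $s_1,s_2,\dots$ one at a time to $S_0$ until the resulting matrix has rank $r$, and let $M\in\{0,1,2,\dots\}\cup\{\infty\}$ be the total number of rows appended ($M=\infty$ if rank $r$ is never reached). Then for every $0<\delta<1$, $$\mathbb{P}\Bigl(M>\Bigl(1+\ln\frac1\delta\Bigr)\sum_{i=r_0+1}^{r}\frac{1}{1-\frac{i(i-1)}{n(n-1)}}\Bigr)\le\delta,$$ and $$\mathbb{E}[M]\le\sum_{i=r_0+1}^{r}\frac{1}{1-\frac{i(i-1)}{n(n-1)}}.$$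 -/

import Mathlib

open MeasureTheory ProbabilityTheory
open scoped ENNReal

noncomputable section

/-- The row vector `s_(p,q)` in `ℝⁿ`: entry `1` at `p`, entry `-1` at `q`, zero elsewhere
(used for `p ≠ q`). -/
def selectionRow {n : ℕ} (p q : Fin n) : Fin n → ℝ :=
  fun j => if j = p then 1 else if j = q then -1 else 0

/-- A selection matrix: every row is `s_(p,q)` for some distinct indices `p`, `q`. -/
def IsSelectionMatrix {m n : ℕ} (S : Matrix (Fin m) (Fin n) ℝ) : Prop :=
  ∀ i, ∃ p q : Fin n, p ≠ q ∧ S i = selectionRow p q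

/-- For `n ≥ 2` and any `p`, the index set `[n] \ {p}` is nonempty. -/
theorem compl_singleton_nonempty_of_two_le {n : ℕ} (hn : 2 ≤ n) (p : Fin n) :
    (({p} : Finset (Fin n))ᶜ).Nonempty := by
  haveI : Nontrivial (Fin n) := Fin.nontrivial_iff_two_le.mpr hn
  obtain ⟨q, hq⟩ := exists_ne p
  exact ⟨q, by simpa using hq⟩

/-- The law of a random pair `(p, q)`: `p` is uniform on `[n]` and, given `p`,
`q` is uniform on `[n] \ {p}`. -/
def randomPair (n : ℕ) (hn : 2 ≤ n) : PMF (Fin n × Fin n) :=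
  haveI : Nonempty (Fin n) := ⟨⟨0, by omega⟩⟩
  (PMF.uniformOfFintype (Fin n)).bind fun p =>
    (PMF.uniformOfFinset (({p} : Finset (Fin n))ᶜ)
      (compl_singleton_nonempty_of_two_le hn p)).map fun q => (p, q)

/-- The `k × n` matrix whose rows are `s_(p,q)` for the first `k` pairs `(p,q)` of a sequence. -/
def sampledMatrix {n : ℕ} (x : ℕ → Fin n × Fin n) (k : ℕ) : Matrix (Fin k) (Fin n) ℝ :=
  Matrix.of fun i => selectionRow (x i).1 (x i).2

/-- The number of rows appended to `S₀`, one after the other along the sequence `x` of pairs,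
until the stacked matrix has rank `r`; it is `⊤` if this never happens. -/
def rowsUntilRank {m n : ℕ} (S₀ : Matrix (Fin m) (Fin n) ℝ) (r : ℕ)
    (x : ℕ → Fin n × Fin n) : ℕ∞ :=
  ⨅ (k : ℕ) (_ : (Matrix.fromRows S₀ (sampledMatrix x k)).rank = r), (k : ℕ∞)

end

/-! Let `W` be the current row span, of dimension `d`. A new row fails to raise the rank exactly
when its two indices are equivalent, meaning that their unit vectors agree modulo `W`. The
differences between non-representatives and their representatives are independent in `W`, so at most
`d * (d + 1)` ordered pairs are bad (`card_spannedPairs_le`). Whatever the past, the rank therefore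
rises from `d` with probability at least `incProb n (d + 1)`.

Antitone functions of the rank then satisfy a one-step inequality (`integral_stackedRank_succ_le`).
With `waitingSum` it bounds the mean, as for a sum of geometric waiting times. With `tailPotential`
at rate `u = 1 / b`, where `b` is the bound on the mean, it bounds the probability of being below
rank `r` after `k` rows; Bernoulli's inequality turns this into `exp (1 - x / b)` for `k = ⌊x⌋₊`,
which is `δ` at `x = (1 + log (1 / δ)) * b`. -/

/-! ### Counting the pairs that do not raise the rank. -/

theorem selectionRow_eq {n : ℕ} {p q : Fin n} (h : p ≠ q) :
    selectionRow p q = Pi.single p (1 : ℝ) - Pi.single q 1 := by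
  funext j
  by_cases h1 : j = p
  · subst h1; simp [selectionRow, h]
  · by_cases h2 : j = q <;> simp [selectionRow, h1, h2]
    subst h2; simp [h1]

/-- Indices whose unit vectors agree modulo the subspace `W`. -/
def unitSetoid {n : ℕ} (W : Submodule ℝ (Fin n → ℝ)) : Setoid (Fin n) where
  r p q := (Pi.single p (1 : ℝ) - Pi.single q 1 : Fin n → ℝ) ∈ W
  iseqv :=
    { refl := fun p => by simp
      symm := fun {p q} h => by simpa using W.neg_mem h
      trans := fun {p q s} h h' => by simpa using W.add_mem h h' }

open Classical in
/-- The pairs of distinct indices whose selection row lies in `W`. -/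
noncomputable def spannedPairs {n : ℕ} (W : Submodule ℝ (Fin n → ℝ)) :
    Finset (Fin n × Fin n) :=
  Finset.univ.filter fun z => z.1 ≠ z.2 ∧ selectionRow z.1 z.2 ∈ W

-- A pair of distinct equivalent indices contains at most one representative. With `N` the
-- non-representatives, this leaves `|N| * (|N| - 1)` pairs inside `N` and two orderings for each `p
-- ∈ N` paired with its representative.
open Classical in
theorem card_spannedPairs_le {n : ℕ} (W : Submodule ℝ (Fin n → ℝ)) :
    (spannedPairs W).card ≤ Module.finrank ℝ W * (Module.finrank ℝ W + 1) := by
  set rep : Fin n → Fin n := fun p => (Quotient.mk (unitSetoid W) p).out with hrep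
  have hrel : ∀ p, (Pi.single p (1 : ℝ) - Pi.single (rep p) 1 : Fin n → ℝ) ∈ W := fun p =>
    (unitSetoid W).symm (Quotient.mk_out (s := unitSetoid W) p)
  have hrr : ∀ p, rep (rep p) = rep p := fun p => by simp [hrep]
  have heq : ∀ p q, (Pi.single p (1 : ℝ) - Pi.single q 1 : Fin n → ℝ) ∈ W → rep p = rep q :=
    fun p q h => by
      have : Quotient.mk (unitSetoid W) p = Quotient.mk (unitSetoid W) q := Quotient.sound h
      simp [hrep, this]
  set N : Finset (Fin n) := Finset.univ.filter fun p => rep p ≠ p with hN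
  have hcard : N.card ≤ Module.finrank ℝ W := by
    let v : N → W := fun p => ⟨_, hrel p⟩
    have hv : LinearIndependent ℝ v := by
      rw [Fintype.linearIndependent_iff]
      intro g hg i
      have h1 := congrFun (congrArg Subtype.val hg) i
      simp only [v, Submodule.coe_sum, Submodule.coe_smul, Finset.sum_apply, Pi.smul_apply,
        Pi.sub_apply, smul_eq_mul, ZeroMemClass.coe_zero, Pi.zero_apply] at h1
      -- At coordinate `i` only the `i`-th vector is nonzero, since no representative lies in `N`.
      rw [Finset.sum_eq_single i] at h1
      · have hi : rep i ≠ i := (Finset.mem_filter.1 i.2).2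
        simpa [Pi.single_apply, hi.symm] using h1
      · intro b _ hb
        have h2 : (i : Fin n) ≠ b := fun h => hb (Subtype.ext h.symm)
        have h3 : (i : Fin n) ≠ rep b := fun h => by
          have hi : rep i ≠ i := (Finset.mem_filter.1 i.2).2
          exact hi (by rw [h, hrr])
        simp [h2, h3]
      · simp
    simpa using hv.fintype_card_le_finrank
  have hsub : spannedPairs W ⊆
      (N.offDiag ∪ N.image fun p => (p, rep p)) ∪ N.image fun p => (rep p, p) := by
    rintro ⟨p, q⟩ h
    simp only [spannedPairs, Finset.mem_filter, Finset.mem_univ, true_and] at h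
    rw [selectionRow_eq h.1] at h
    have he := heq p q h.2
    simp only [hN, Finset.mem_union, Finset.mem_offDiag, Finset.mem_filter, Finset.mem_univ,
      true_and, Finset.mem_image, Prod.mk.injEq]
    by_cases hp : rep p = p
    · by_cases hq : rep q = q
      · exact absurd (hp.symm.trans (he.trans hq)) h.1
      · exact Or.inr ⟨q, hq, he.symm.trans hp, rfl⟩
    · by_cases hq : rep q = q
      · exact Or.inl (Or.inr ⟨p, hp, rfl, he.trans hq⟩)
      · exact Or.inl (Or.inl ⟨hp, hq, h.1⟩)
  have h1 := Finset.card_le_card hsub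
  have h2 := Finset.card_union_le (N.offDiag ∪ N.image fun p => (p, rep p))
    (N.image fun p => (rep p, p))
  have h3 := Finset.card_union_le N.offDiag (N.image fun p => (p, rep p))
  have h4 : (N.image fun p => (p, rep p)).card ≤ N.card := Finset.card_image_le
  have h5 : (N.image fun p => (rep p, p)).card ≤ N.card := Finset.card_image_le
  have h6 := Finset.offDiag_card N
  -- Makes the truncated subtraction in `Finset.offDiag_card` harmless.
  have h7 : N.card ≤ N.card * N.card := Nat.le_mul_self _
  have h8 : N.card * (N.card + 1) ≤ Module.finrank ℝ W * (Module.finrank ℝ W + 1) := by gcongr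
  have h9 : N.card * (N.card + 1) = N.card * N.card + N.card := by ring
  omega

theorem finrank_sup_span_singleton {n : ℕ} (W : Submodule ℝ (Fin n → ℝ)) {s : Fin n → ℝ}
    (hs : s ∉ W) :
    Module.finrank ℝ ↥(W ⊔ Submodule.span ℝ {s}) = Module.finrank ℝ W + 1 := by
  apply le_antisymm
  · refine (Submodule.finrank_add_le_finrank_add_finrank _ _).trans ?_
    gcongr
    exact (finrank_span_le_card ({s} : Set (Fin n → ℝ))).trans (by simp)
  · apply Submodule.finrank_lt_finrank_of_lt
    refine lt_of_le_of_ne le_sup_left fun h => hs ?_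
    rw [h]
    exact (le_sup_right : _ ≤ W ⊔ Submodule.span ℝ {s}) (Submodule.mem_span_singleton_self s)

/-! ### One random row added to a fixed subspace. -/

theorem randomPair_apply {n : ℕ} (hn : 2 ≤ n) (z : Fin n × Fin n) :
    randomPair n hn z = if z.1 ≠ z.2 then ((n : ℝ≥0∞) * ((n - 1 : ℕ) : ℝ≥0∞))⁻¹ else 0 := by
  obtain ⟨p, q⟩ := z
  unfold randomPair
  rw [PMF.bind_apply, tsum_fintype, Finset.sum_eq_single p]
  · rw [PMF.map_apply, tsum_fintype, Finset.sum_eq_single q]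
    · by_cases h : p = q
      · simp [h]
      · have h' : q ≠ p := fun e => h e.symm
        simp [h, h', Finset.card_compl]
        rw [ENNReal.mul_inv (by simp) (by simp)]
    · intro b _ hb
      simp [hb.symm]
    · simp
  · intro b _ hb
    rw [PMF.map_apply, tsum_fintype]
    simp [hb.symm]
  · simp

/-- One step of the rank process, in expectation, for an antitone function of the rank. -/
theorem integral_finrank_sup_le {n : ℕ} (hn : 2 ≤ n) (W : Submodule ℝ (Fin n → ℝ))
    (f : ℕ → ℝ) (hf : f (Module.finrank ℝ W + 1) ≤ f (Module.finrank ℝ W)) :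
    ∫ z, f (Module.finrank ℝ ↥(W ⊔ Submodule.span ℝ {selectionRow z.1 z.2}))
        ∂(randomPair n hn).toMeasure ≤
      f (Module.finrank ℝ W + 1) +
        ((Module.finrank ℝ W : ℝ) * (Module.finrank ℝ W + 1) / (n * (n - 1))) *
          (f (Module.finrank ℝ W) - f (Module.finrank ℝ W + 1)) := by
  classical
  set d := Module.finrank ℝ W with hd
  have hn1 : (1 : ℝ) < n := by exact_mod_cast hn
  have hpos : (0 : ℝ) < n * (n - 1) := mul_pos (by linarith) (by linarith)
  have hpr : ∀ z, (randomPair n hn z).toReal =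
      if z.1 ≠ z.2 then ((n : ℝ) * (n - 1))⁻¹ else 0 := fun z => by
    rw [randomPair_apply]
    split_ifs
    · rw [ENNReal.toReal_inv, ENNReal.toReal_mul, ENNReal.toReal_natCast, ENNReal.toReal_natCast,
        Nat.cast_sub (by omega : 1 ≤ n), Nat.cast_one]
    · simp
  have hsum : ∑ z, (randomPair n hn z).toReal = 1 := by
    rw [← ENNReal.toReal_sum (fun z _ => PMF.apply_ne_top _ z)]
    rw [← tsum_fintype (L := .unconditional _), PMF.tsum_coe, ENNReal.toReal_one]
  rw [PMF.integral_eq_sum]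
  have key : ∀ z, (randomPair n hn z).toReal •
        f (Module.finrank ℝ ↥(W ⊔ Submodule.span ℝ {selectionRow z.1 z.2})) =
      (randomPair n hn z).toReal * f (d + 1) +
        if z ∈ spannedPairs W then ((n : ℝ) * (n - 1))⁻¹ * (f d - f (d + 1)) else 0 := fun z => by
    rw [hpr, smul_eq_mul]
    by_cases h : z.1 ≠ z.2
    · by_cases h' : selectionRow z.1 z.2 ∈ W
      · have hsup : W ⊔ Submodule.span ℝ {selectionRow z.1 z.2} = W :=
          sup_eq_left.2 (by simpa using h')
        rw [hsup, ← hd]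
        simp [spannedPairs, h, h']
        ring
      · rw [finrank_sup_span_singleton W h']
        simp [spannedPairs, h, h', ← hd]
    · simp [spannedPairs, h]
  rw [Finset.sum_congr rfl fun z _ => key z, Finset.sum_add_distrib, ← Finset.sum_mul, hsum,
    one_mul, Finset.sum_ite_mem, Finset.univ_inter, Finset.sum_const, nsmul_eq_mul]
  have hc : ((spannedPairs W).card : ℝ) ≤ d * (d + 1) := by
    exact_mod_cast card_spannedPairs_le W
  have : 0 ≤ ((n : ℝ) * (n - 1))⁻¹ * (f d - f (d + 1)) :=
    mul_nonneg (inv_nonneg.2 hpos.le) (by linarith)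
  calc _ ≤ f (d + 1) + (d * (d + 1) : ℝ) * (((n : ℝ) * (n - 1))⁻¹ * (f d - f (d + 1))) := by
        gcongr
    _ = _ := by rw [div_eq_mul_inv]; ring

/-! ### The rank process and its hitting time. -/

/-- The span of the rows of `S` and of the selection rows of finitely many pairs. -/
noncomputable def prefixSpan {m n : ℕ} (S : Matrix (Fin m) (Fin n) ℝ) (k : ℕ)
    (y : Finset.range k → Fin n × Fin n) : Submodule ℝ (Fin n → ℝ) :=
  Submodule.span ℝ (Set.range S.row ∪ Set.range fun i => selectionRow (y i).1 (y i).2)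

/-- The rank of `S` after the first `k` rows have been appended. -/
noncomputable def stackedRank {m n : ℕ} (S : Matrix (Fin m) (Fin n) ℝ)
    (x : ℕ → Fin n × Fin n) (k : ℕ) : ℕ :=
  Module.finrank ℝ (prefixSpan S k fun i => x i)

theorem rank_fromRows_sampledMatrix {m n : ℕ} (S : Matrix (Fin m) (Fin n) ℝ)
    (x : ℕ → Fin n × Fin n) (k : ℕ) :
    (Matrix.fromRows S (sampledMatrix x k)).rank = stackedRank S x k := by
  suffices Set.range (Matrix.fromRows S (sampledMatrix x k)).row = Set.range S.row ∪
      Set.range fun i : Finset.range k => selectionRow (x i).1 (x i).2 by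
    rw [Matrix.rank_eq_finrank_span_row, stackedRank, prefixSpan, this]
  ext v
  simp only [Set.mem_range, Set.mem_union, Sum.exists]
  refine or_congr (exists_congr fun i => Iff.rfl) ⟨?_, ?_⟩
  · rintro ⟨i, rfl⟩
    exact ⟨⟨i, Finset.mem_range.2 i.2⟩, rfl⟩
  · rintro ⟨i, rfl⟩
    exact ⟨⟨i, Finset.mem_range.1 i.2⟩, rfl⟩

theorem prefixSpan_succ {m n : ℕ} (S : Matrix (Fin m) (Fin n) ℝ) (x : ℕ → Fin n × Fin n) (k : ℕ) :
    prefixSpan S (k + 1) (fun i => x i) =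
      prefixSpan S k (fun i => x i) ⊔ Submodule.span ℝ {selectionRow (x k).1 (x k).2} := by
  rw [prefixSpan, prefixSpan, ← Submodule.span_union]
  congr 1
  ext v
  simp only [Set.mem_range, Set.mem_union, Subtype.exists, Finset.mem_range, exists_prop,
    Set.mem_singleton_iff, or_assoc, Nat.lt_succ_iff_lt_or_eq, or_and_right, exists_or,
    exists_eq_left]
  rw [eq_comm (a := v)]

theorem stackedRank_zero {m n : ℕ} (S : Matrix (Fin m) (Fin n) ℝ) (x : ℕ → Fin n × Fin n) :
    stackedRank S x 0 = S.rank := by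
  have : IsEmpty (Finset.range 0) := ⟨fun i => by simpa using i.2⟩
  rw [Matrix.rank_eq_finrank_span_row, stackedRank, prefixSpan, Set.range_eq_empty (fun i : Finset.range 0 =>
    selectionRow (x i).1 (x i).2), Set.union_empty]

theorem stackedRank_succ_le {m n : ℕ} (S : Matrix (Fin m) (Fin n) ℝ) (x : ℕ → Fin n × Fin n)
    (k : ℕ) : stackedRank S x (k + 1) ≤ stackedRank S x k + 1 := by
  rw [stackedRank, prefixSpan_succ]
  refine (Submodule.finrank_add_le_finrank_add_finrank _ _).trans ?_
  rw [stackedRank]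
  gcongr
  exact (finrank_span_le_card ({selectionRow (x k).1 (x k).2} : Set (Fin n → ℝ))).trans (by simp)

/-- Steps of size at most one cannot jump over `r`, so stopping at rank exactly `r` is stopping at
rank at least `r`. -/
theorem exists_rank_eq_of_le_stackedRank {m n : ℕ} (S : Matrix (Fin m) (Fin n) ℝ)
    (x : ℕ → Fin n × Fin n) {r : ℕ} (hr : S.rank ≤ r) (k : ℕ) (hk : r ≤ stackedRank S x k) :
    ∃ j ≤ k, stackedRank S x j = r := by
  induction k with
  | zero => exact ⟨0, le_rfl, le_antisymm (stackedRank_zero S x ▸ hr) hk⟩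
  | succ k ih =>
    by_cases h : r ≤ stackedRank S x k
    · obtain ⟨j, hj, e⟩ := ih h
      exact ⟨j, by omega, e⟩
    · have := stackedRank_succ_le S x k
      exact ⟨k + 1, le_rfl, by omega⟩

theorem rowsUntilRank_le {m n : ℕ} (S : Matrix (Fin m) (Fin n) ℝ)
    (x : ℕ → Fin n × Fin n) {r : ℕ} (hr : S.rank ≤ r) {k : ℕ} (hk : r ≤ stackedRank S x k) :
    rowsUntilRank S r x ≤ k := by
  obtain ⟨j, hj, e⟩ := exists_rank_eq_of_le_stackedRank S x hr k hk
  refine (iInf₂_le (f := fun (k : ℕ)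
    (_ : (Matrix.fromRows S (sampledMatrix x k)).rank = r) => (k : ℕ∞)) j
    ((rank_fromRows_sampledMatrix S x j).trans e)).trans ?_
  exact_mod_cast hj

-- Turns the mean of the hitting time into a sum of probabilities. If `r` is never reached, the
-- series is infinite.
open Classical in
theorem rowsUntilRank_le_tsum {m n : ℕ} (S : Matrix (Fin m) (Fin n) ℝ)
    (x : ℕ → Fin n × Fin n) {r : ℕ} (hr : S.rank ≤ r) :
    (rowsUntilRank S r x : ℝ≥0∞) ≤ ∑' k, if stackedRank S x k < r then (1 : ℝ≥0∞) else 0 := by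
  by_cases h : ∃ k, r ≤ stackedRank S x k
  · have h1 : (rowsUntilRank S r x : ℝ≥0∞) ≤ (Nat.find h : ℝ≥0∞) := by
      exact_mod_cast rowsUntilRank_le S x hr (Nat.find_spec h)
    refine h1.trans ?_
    refine le_trans (le_of_eq ?_) (ENNReal.sum_le_tsum (Finset.range (Nat.find h)))
    rw [Finset.sum_congr rfl (g := fun _ => (1 : ℝ≥0∞))]
    · simp
    · intro k hk
      have := Nat.find_min h (Finset.mem_range.1 hk)
      rw [if_pos (by omega)]
  · push Not at h
    simp [h]

theorem measurable_stackedRank {m n : ℕ} (S : Matrix (Fin m) (Fin n) ℝ) {Ω : Type*}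
    [MeasurableSpace Ω] (X : ℕ → Ω → Fin n × Fin n) (hX : ∀ i, Measurable (X i)) (k : ℕ) :
    Measurable fun ω => stackedRank S (fun i => X i ω) k :=
  (measurable_of_finite fun y => Module.finrank ℝ (prefixSpan S k y)).comp
    (measurable_pi_lambda _ fun i => hX i)

theorem stackedRank_le {m n : ℕ} (S : Matrix (Fin m) (Fin n) ℝ) (x : ℕ → Fin n × Fin n) (k : ℕ) :
    stackedRank S x k ≤ n := by
  simpa [stackedRank] using Submodule.finrank_le (prefixSpan S k fun i => x i)

theorem integrable_comp_stackedRank {m n : ℕ} (S : Matrix (Fin m) (Fin n) ℝ) {Ω : Type*}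
    [MeasurableSpace Ω] (P : Measure Ω) [IsProbabilityMeasure P]
    (X : ℕ → Ω → Fin n × Fin n) (hX : ∀ i, Measurable (X i)) (k : ℕ) (f : ℕ → ℝ) :
    Integrable (fun ω => f (stackedRank S (fun i => X i ω) k)) P := by
  refine Integrable.of_bound
    ((measurable_of_countable f).comp (measurable_stackedRank S X hX k)).aestronglyMeasurable
    (∑ i ∈ Finset.range (n + 1), ‖f i‖) (Filter.Eventually.of_forall fun ω => ?_)
  exact Finset.single_le_sum (f := fun i => ‖f i‖) (fun _ _ => norm_nonneg _)
    (Finset.mem_range.2 (Nat.lt_succ_of_le (stackedRank_le S (fun i => X i ω) k)))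

/-! ### One step of the process, given the past. -/

theorem integral_comp_prodMk_of_indepFun {Ω α β : Type*} [MeasurableSpace Ω] (P : Measure Ω)
    [IsProbabilityMeasure P] [Finite α] [Finite β] [MeasurableSpace α] [MeasurableSpace β]
    [MeasurableSingletonClass α] [MeasurableSingletonClass β] {Y : Ω → α} {Z : Ω → β}
    (hY : Measurable Y) (hZ : Measurable Z) (h : IndepFun Y Z P) (F : α × β → ℝ) :
    ∫ ω, F (Y ω, Z ω) ∂P = ∫ y, ∫ z, F (y, z) ∂(P.map Z) ∂(P.map Y) := by
  have : IsProbabilityMeasure (P.map Y) := Measure.isProbabilityMeasure_map hY.aemeasurable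
  have : IsProbabilityMeasure (P.map Z) := Measure.isProbabilityMeasure_map hZ.aemeasurable
  rw [← integral_prod F Integrable.of_finite,
    ← (indepFun_iff_map_prod_eq_prod_map_map hY.aemeasurable hZ.aemeasurable).1 h,
    integral_map (hY.prodMk hZ).aemeasurable (measurable_of_finite F).aestronglyMeasurable]

/-- One step of the rank process, in expectation. -/
theorem integral_stackedRank_succ_le {m n : ℕ} (hn : 2 ≤ n) (S : Matrix (Fin m) (Fin n) ℝ)
    {Ω : Type*} [MeasurableSpace Ω] (P : Measure Ω) [IsProbabilityMeasure P]
    (X : ℕ → Ω → Fin n × Fin n) (hX : ∀ i, Measurable (X i))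
    (hlaw : ∀ i, P.map (X i) = (randomPair n hn).toMeasure) (hindep : iIndepFun X P)
    (f g : ℕ → ℝ) (hf : Antitone f)
    (hg : ∀ d, d ≤ n → f (d + 1) + ((d : ℝ) * (d + 1) / (n * (n - 1))) * (f d - f (d + 1)) ≤ g d)
    (k : ℕ) :
    ∫ ω, f (stackedRank S (fun i => X i ω) (k + 1)) ∂P ≤
      ∫ ω, g (stackedRank S (fun i => X i ω) k) ∂P := by
  let Y : Ω → (Finset.range k → Fin n × Fin n) := fun ω i => X i ω
  have hY : Measurable Y := measurable_pi_lambda _ fun i => hX i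
  -- The first `k` pairs form one finite-valued variable, so conditioning on the past is a finite
  -- product integral.
  have hind : IndepFun Y (X k) P :=
    (hindep.indepFun_finset (Finset.range k) {k} (by simp) hX).comp (φ := id)
      (ψ := fun z : ({k} : Finset ℕ) → Fin n × Fin n => z ⟨k, by simp⟩) measurable_id
      (measurable_pi_apply _)
  let F : (Finset.range k → Fin n × Fin n) × (Fin n × Fin n) → ℝ := fun z =>
    f (Module.finrank ℝ ↥(prefixSpan S k z.1 ⊔ Submodule.span ℝ {selectionRow z.2.1 z.2.2}))
  have : IsProbabilityMeasure (P.map Y) := Measure.isProbabilityMeasure_map hY.aemeasurable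
  calc ∫ ω, f (stackedRank S (fun i => X i ω) (k + 1)) ∂P
      = ∫ ω, F (Y ω, X k ω) ∂P := by
        refine integral_congr_ae (Filter.Eventually.of_forall fun ω => ?_)
        simp only [stackedRank, F, Y]
        rw [prefixSpan_succ S (fun i => X i ω) k]
    _ = ∫ y, ∫ z, F (y, z) ∂(P.map (X k)) ∂(P.map Y) :=
        integral_comp_prodMk_of_indepFun P hY (hX k) hind F
    _ ≤ ∫ y, g (Module.finrank ℝ (prefixSpan S k y)) ∂(P.map Y) := by
        refine integral_mono Integrable.of_finite Integrable.of_finite fun y => ?_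
        have hle : Module.finrank ℝ (prefixSpan S k y) ≤ n := by
          simpa using Submodule.finrank_le (prefixSpan S k y)
        have h := integral_finrank_sup_le hn (prefixSpan S k y) f (hf (Nat.le_succ _))
        rw [← hlaw k] at h
        exact h.trans (hg _ hle)
    _ = _ := integral_map hY.aemeasurable (measurable_of_finite _).aestronglyMeasurable

/-! ### Real inequalities for the tail bound. -/

/-- Since `1 - 1 / c` is the inverse of `1 + 1 / (c - 1)`, this is the growth of `(1 + 1 / t) ^ t`,
a case of Bernoulli's inequality. -/
theorem one_sub_inv_rpow_le {a b : ℝ} (ha : 1 ≤ a) (hab : a ≤ b) :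
    (1 - 1 / b) ^ (b - 1) ≤ (1 - 1 / a) ^ (a - 1) := by
  have hb : 0 ≤ 1 - 1 / b := by
    rw [sub_nonneg, div_le_one (by linarith)]; linarith
  -- At `a = 1` the right side is `0 ^ 0 = 1`.
  rcases ha.eq_or_lt with rfl | ha
  · simpa using Real.rpow_le_one hb (by simp; linarith) (by linarith : 0 ≤ b - 1)
  have hc : 0 < a - 1 := by linarith
  have hd : 0 < b - 1 := by linarith
  have key : (1 + 1 / (a - 1)) ^ (a - 1) ≤ (1 + 1 / (b - 1)) ^ (b - 1) := by
    have h := one_add_mul_self_le_rpow_one_add (s := 1 / (b - 1)) (p := (b - 1) / (a - 1))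
      (by linarith [one_div_pos.2 hd]) (by rw [le_div_iff₀ hc]; linarith)
    rw [show (b - 1) / (a - 1) * (1 / (b - 1)) = 1 / (a - 1) by field_simp] at h
    refine (Real.rpow_le_rpow (by positivity) h hc.le).trans (le_of_eq ?_)
    rw [← Real.rpow_mul (by positivity), div_mul_cancel₀ _ hc.ne']
  have hinv : ∀ c : ℝ, 1 < c → 1 - 1 / c = (1 + 1 / (c - 1))⁻¹ := fun c h => by
    have h1 : c - 1 ≠ 0 := by linarith
    have h2 : c ≠ 0 := by linarith
    rw [one_add_div h1, inv_div, sub_add_cancel, sub_div, div_self h2]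
  rw [hinv a ha, hinv b (by linarith), Real.inv_rpow (by positivity), Real.inv_rpow (by positivity)]
  gcongr

/-- Bernoulli with exponent `w i / M ≤ 1` bounds each factor below by a power of `1 - M / b`. The
exponents add up to `b / M - 1`, and `b / M ≤ b` allows monotonicity. -/
theorem one_sub_inv_rpow_le_prod {ι : Type*} (I : Finset ι) (w : ι → ℝ) {M b : ℝ} (hM : 1 ≤ M)
    (hw : ∀ i ∈ I, 0 < w i) (hwM : ∀ i ∈ I, w i ≤ M) (hb : M + ∑ i ∈ I, w i = b) :
    (1 - 1 / b) ^ (b - 1) ≤ ∏ i ∈ I, (1 - w i / b) := by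
  have hM0 : 0 < M := by linarith
  have hs : 0 ≤ ∑ i ∈ I, w i := Finset.sum_nonneg fun i hi => (hw i hi).le
  have hb0 : 0 < b := by linarith
  rcases I.eq_empty_or_nonempty with rfl | hI
  · rw [Finset.prod_empty]
    have h1 : 1 / b ≤ 1 := by rw [div_le_one hb0]; linarith
    exact Real.rpow_le_one (by linarith) (by simp; linarith) (by linarith)
  have hs' : 0 < ∑ i ∈ I, w i := Finset.sum_pos hw hI
  have hMb : M / b < 1 := by rw [div_lt_one hb0]; linarith
  have hMb0 : 0 < M / b := by positivity
  calc (1 - 1 / b) ^ (b - 1) ≤ (1 - 1 / (b / M)) ^ (b / M - 1) :=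
        one_sub_inv_rpow_le (by rw [le_div_iff₀ hM0]; linarith) (div_le_self hb0.le hM)
    _ = ∏ i ∈ I, (1 - M / b) ^ (w i / M) := by
        rw [← Real.rpow_sum_of_pos (by linarith), ← Finset.sum_div, one_div_div]
        congr 1
        rw [← hb]; field_simp; ring
    _ ≤ ∏ i ∈ I, (1 - w i / b) := by
        refine Finset.prod_le_prod (fun i _ => Real.rpow_nonneg (by linarith) _) fun i hi => ?_
        have h := rpow_one_add_le_one_add_mul_self (s := -(M / b)) (p := w i / M) (by linarith)
          (div_nonneg (hw i hi).le hM0.le) ((div_le_one hM0).2 (hwM i hi))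
        refine (le_of_eq ?_).trans (h.trans (le_of_eq ?_))
        · rw [sub_eq_add_neg]
        · field_simp
          ring

theorem one_sub_inv_pow_mul_prod_le_exp {ι : Type*} (I : Finset ι) (p : ι → ℝ) {q b x : ℝ} {k : ℕ}
    (hq : 0 < q) (hq1 : q ≤ 1) (hp : ∀ i ∈ I, q ≤ p i) (hb : 1 / q + ∑ i ∈ I, 1 / p i = b)
    (hb1 : 1 < b) (hbx : b ≤ x) (hxk : x ≤ k + 1) :
    (1 - 1 / b) ^ k * ∏ i ∈ I, p i / (p i - 1 / b) ≤ Real.exp (1 - x / b) := by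
  have hb0 : 0 < b := by linarith
  have hpp : ∀ i ∈ I, 0 < p i := fun i hi => hq.trans_le (hp i hi)
  have hu : 1 / b < 1 := by rw [div_lt_one hb0]; exact hb1
  have hv : 0 < 1 - 1 / b := by linarith
  have h1 := one_sub_inv_rpow_le_prod I (fun i => 1 / p i) (M := 1 / q) (b := b)
    (by rw [le_div_iff₀ hq]; linarith) (fun i hi => one_div_pos.2 (hpp i hi))
    (fun i hi => one_div_le_one_div_of_le hq (hp i hi)) hb
  have hpos : 0 < ∏ i ∈ I, (1 - 1 / p i / b) := lt_of_lt_of_le (Real.rpow_pos_of_pos hv _) h1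
  have h2 : ∏ i ∈ I, p i / (p i - 1 / b) = (∏ i ∈ I, (1 - 1 / p i / b))⁻¹ := by
    rw [← Finset.prod_inv_distrib]
    refine Finset.prod_congr rfl fun i hi => ?_
    have h3 := (hpp i hi).ne'
    rw [show 1 - 1 / p i / b = (p i - 1 / b) / p i by field_simp, inv_div]
  have h3 : (1 - 1 / b) ^ k = (1 - 1 / b) ^ ((k : ℝ) + 1 - b) * (1 - 1 / b) ^ (b - 1) := by
    rw [← Real.rpow_add hv, ← Real.rpow_natCast]; congr 1; ring
  -- The product costs `b - 1` of the `k` powers; the remaining exponent is nonnegative because `b ≤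
  -- x ≤ k + 1`.
  have h4 : (1 - 1 / b) ^ ((k : ℝ) + 1 - b) ≤ Real.exp (1 - x / b) := by
    have h5 : 1 - 1 / b ≤ Real.exp (-(1 / b)) := by
      linarith [Real.add_one_le_exp (-(1 / b))]
    refine (Real.rpow_le_rpow hv.le h5 (by linarith)).trans ?_
    rw [← Real.exp_mul, Real.exp_le_exp]
    have : x / b ≤ (k + 1) / b := by gcongr
    have h6 : -(1 / b) * ((k : ℝ) + 1 - b) = 1 - (k + 1) / b := by field_simp; ring
    linarith
  rw [h2, h3, ← div_eq_mul_inv, div_le_iff₀ hpos]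
  exact mul_le_mul h4 h1 (Real.rpow_nonneg hv.le _) (Real.exp_pos _).le

/-! ### Success probabilities and the two potentials. -/

/-- The least probability that a new row raises the rank to `i`. -/
noncomputable def incProb (n i : ℕ) : ℝ := 1 - ((i : ℝ) * ((i : ℝ) - 1)) / ((n : ℝ) * ((n : ℝ) - 1))

theorem incProb_strictAnti {n : ℕ} (hn : 2 ≤ n) {i j : ℕ} (hi : 1 ≤ i) (hij : i < j) :
    incProb n j < incProb n i := by
  have hn1 : (1 : ℝ) < n := by exact_mod_cast hn
  have hi' : (1 : ℝ) ≤ i := by exact_mod_cast hi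
  have hij' : (i : ℝ) < j := by exact_mod_cast hij
  have hpos : (0 : ℝ) < n * (n - 1) := mul_pos (by linarith) (by linarith)
  have : (i : ℝ) * (i - 1) < j * (j - 1) := by nlinarith
  have := div_lt_div_of_pos_right this hpos
  unfold incProb
  linarith

theorem incProb_pos {n : ℕ} (hn : 2 ≤ n) {i : ℕ} (hi : 1 ≤ i) (hin : i < n) : 0 < incProb n i := by
  refine lt_of_eq_of_lt ?_ (incProb_strictAnti hn hi hin)
  have hn1 : (1 : ℝ) < n := by exact_mod_cast hn
  rw [incProb, div_self (mul_pos (by linarith) (by linarith)).ne', sub_self]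

theorem incProb_lt_one {n : ℕ} (hn : 2 ≤ n) {i : ℕ} (hi : 2 ≤ i) : incProb n i < 1 := by
  simpa [incProb] using incProb_strictAnti hn le_rfl hi

theorem incProb_succ (n d : ℕ) :
    (d : ℝ) * (d + 1) / (n * (n - 1)) = 1 - incProb n (d + 1) := by
  rw [incProb]; push_cast; ring

/-- The sum bounding the expected number of rows needed to go from rank `d` to rank `r`. -/
noncomputable def waitingSum (n r d : ℕ) : ℝ := ∑ i ∈ Finset.Icc (d + 1) r, 1 / incProb n i

theorem waitingSum_of_le (n : ℕ) {r d : ℕ} (h : r ≤ d) : waitingSum n r d = 0 := by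
  rw [waitingSum, Finset.Icc_eq_empty (by omega), Finset.sum_empty]

theorem waitingSum_of_lt (n : ℕ) {r d : ℕ} (h : d < r) :
    waitingSum n r d = 1 / incProb n (d + 1) + waitingSum n r (d + 1) := by
  rw [waitingSum, ← Finset.add_sum_Ioc_eq_sum_Icc (by omega), waitingSum,
    Finset.Icc_add_one_left_eq_Ioc (d + 1) r]

theorem waitingSum_nonneg {n r : ℕ} (hn : 2 ≤ n) (hrn : r < n) (d : ℕ) : 0 ≤ waitingSum n r d :=
  Finset.sum_nonneg fun i hi => by
    rw [Finset.mem_Icc] at hi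
    exact (one_div_pos.2 (incProb_pos hn (by omega) (by omega))).le

theorem waitingSum_antitone {n r : ℕ} (hn : 2 ≤ n) (hrn : r < n) : Antitone (waitingSum n r) :=
  antitone_nat_of_succ_le fun d => by
    rcases lt_or_ge d r with h | h
    · rw [waitingSum_of_lt n h]
      linarith [one_div_pos.2 (incProb_pos hn (by omega : 1 ≤ d + 1) (by omega))]
    · rw [waitingSum_of_le n h, waitingSum_of_le n (by omega)]

/-- The potential function behind the exponential tail bound. -/
noncomputable def tailPotential (n r : ℕ) (u : ℝ) (d : ℕ) : ℝ :=
  if d < r then ∏ i ∈ Finset.Ico (d + 1) r, incProb n i / (incProb n i - u) else 0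

theorem one_le_tailPotential {n r : ℕ} {u : ℝ} (hu : 0 ≤ u)
    (hup : ∀ i, 1 ≤ i → i < r → u < incProb n i) {d : ℕ} (h : d < r) :
    1 ≤ tailPotential n r u d := by
  rw [tailPotential, if_pos h]
  refine Finset.one_le_prod fun i hi => ?_
  rw [Finset.mem_Ico] at hi
  have := hup i (by omega) hi.2
  rw [one_le_div (by linarith)]
  linarith

theorem tailPotential_succ {n r : ℕ} {u : ℝ} {d : ℕ} (h : d + 1 < r) :
    tailPotential n r u d =
      incProb n (d + 1) / (incProb n (d + 1) - u) * tailPotential n r u (d + 1) := by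
  rw [tailPotential, tailPotential, if_pos (by omega), if_pos h,
    Finset.prod_eq_prod_Ico_succ_bot h]

/-- The factors are chosen to give equality below `r - 1`. From `r - 1` a success sends the
potential to `0`, so no factor for `i = r` is needed and `u = incProb n r` is allowed. -/
theorem tailPotential_step {n r : ℕ} {u : ℝ} (hu : 0 ≤ u) (hur : u ≤ incProb n r)
    (hup : ∀ i, 1 ≤ i → i < r → u < incProb n i) (d : ℕ) :
    tailPotential n r u (d + 1) + (1 - incProb n (d + 1)) *
      (tailPotential n r u d - tailPotential n r u (d + 1)) ≤ (1 - u) * tailPotential n r u d := by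
  rcases lt_trichotomy (d + 1) r with h | h | h
  · rw [tailPotential_succ h]
    have := hup (d + 1) (by omega) h
    have h' : incProb n (d + 1) - u ≠ 0 := by linarith
    apply le_of_eq
    field_simp
    ring
  · have h1 : tailPotential n r u (d + 1) = 0 := if_neg (by omega)
    have h2 := one_le_tailPotential hu hup (by omega : d < r)
    rw [h1, h]
    nlinarith
  · have h1 : tailPotential n r u (d + 1) = 0 := if_neg (by omega)
    have h2 : tailPotential n r u d = 0 := if_neg (by omega)
    simp [h1, h2]

theorem tailPotential_antitone {n r : ℕ} {u : ℝ} (hu : 0 ≤ u)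
    (hup : ∀ i, 1 ≤ i → i < r → u < incProb n i) : Antitone (tailPotential n r u) :=
  antitone_nat_of_succ_le fun d => by
    by_cases h : d + 1 < r
    · rw [tailPotential_succ h]
      have h1 := hup (d + 1) (by omega) h
      have h2 := one_le_tailPotential hu hup h
      refine le_mul_of_one_le_left (by linarith) ?_
      rw [one_le_div (by linarith)]
      linarith
    · rw [show tailPotential n r u (d + 1) = 0 from if_neg h]
      by_cases h' : d < r
      · linarith [one_le_tailPotential hu hup h']
      · exact (if_neg h').ge

/-! ### Mean and tail of the number of rows. -/

section RankProcess

variable {m n : ℕ} (hn : 2 ≤ n) (S : Matrix (Fin m) (Fin n) ℝ)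
  {Ω : Type*} [MeasurableSpace Ω] (P : Measure Ω) [IsProbabilityMeasure P]
  (X : ℕ → Ω → Fin n × Fin n) (hX : ∀ i, Measurable (X i))
  (hlaw : ∀ i, P.map (X i) = (randomPair n hn).toMeasure) (hindep : iIndepFun X P)

open Classical in
include hX in
theorem lintegral_ite_stackedRank_lt (r k : ℕ) :
    ∫⁻ ω, (if stackedRank S (fun i => X i ω) k < r then 1 else 0) ∂P =
      ENNReal.ofReal (∫ ω, (if stackedRank S (fun i => X i ω) k < r then 1 else 0) ∂P) := by
  rw [ofReal_integral_eq_lintegral_ofReal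
    (integrable_comp_stackedRank S P X hX k fun d => if d < r then 1 else 0)
    (Filter.Eventually.of_forall fun ω => by dsimp only; split_ifs <;> simp)]
  refine lintegral_congr fun ω => ?_
  split_ifs <;> simp

-- While the rank is below `r`, each step lowers `waitingSum` by at least one on average; this is
-- the telescoped form.
open Classical in
include hX hlaw hindep in
theorem sum_integral_stackedRank_lt_le {r : ℕ} (hrn : r < n) (K : ℕ) :
    ∑ k ∈ Finset.range K, ∫ ω, (if stackedRank S (fun i => X i ω) k < r then (1 : ℝ) else 0) ∂P +
      ∫ ω, waitingSum n r (stackedRank S (fun i => X i ω) K) ∂P ≤ waitingSum n r S.rank := by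
  induction K with
  | zero => simp [stackedRank_zero]
  | succ K ih =>
    have h := integral_stackedRank_succ_le hn S P X hX hlaw hindep (waitingSum n r)
      (fun d => waitingSum n r d - if d < r then 1 else 0) (waitingSum_antitone hn hrn)
      (fun d _ => by
        rw [incProb_succ]
        by_cases h : d < r
        · have := incProb_pos hn (by omega : 1 ≤ d + 1) (by omega)
          rw [if_pos h, waitingSum_of_lt n h]
          apply le_of_eq
          field_simp
          ring
        · rw [if_neg h, waitingSum_of_le n (by omega), waitingSum_of_le n (by omega)]
          simp) K
    rw [integral_sub (integrable_comp_stackedRank S P X hX K _)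
      (integrable_comp_stackedRank S P X hX K fun d => if d < r then 1 else 0)] at h
    rw [Finset.sum_range_succ]
    linarith

include hX hlaw hindep in
theorem lintegral_rowsUntilRank_le {r : ℕ} (hSr : S.rank ≤ r) (hrn : r < n) :
    ∫⁻ ω, (rowsUntilRank S r (fun i => X i ω) : ℝ≥0∞) ∂P ≤
      ENNReal.ofReal (waitingSum n r S.rank) := by
  classical
  refine (lintegral_mono fun ω => rowsUntilRank_le_tsum S (fun i => X i ω) hSr).trans ?_
  have hm : ∀ k, AEMeasurable
      (fun ω => if stackedRank S (fun i => X i ω) k < r then (1 : ℝ≥0∞) else 0) P := fun k =>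
    ((measurable_of_countable fun d => if d < r then (1 : ℝ≥0∞) else 0).comp
      (measurable_stackedRank S X hX k)).aemeasurable
  rw [lintegral_tsum hm]
  refine ENNReal.tsum_le_of_sum_range_le fun K => ?_
  simp only [lintegral_ite_stackedRank_lt S P X hX]
  rw [← ENNReal.ofReal_sum_of_nonneg fun k _ => integral_nonneg fun ω => by
    dsimp only; split_ifs <;> simp]
  refine ENNReal.ofReal_le_ofReal ?_
  have h := sum_integral_stackedRank_lt_le hn S P X hX hlaw hindep hrn K
  have h' : 0 ≤ ∫ ω, waitingSum n r (stackedRank S (fun i => X i ω) K) ∂P :=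
    integral_nonneg fun ω => waitingSum_nonneg hn hrn _
  linarith

include hX hlaw hindep in
theorem measure_stackedRank_lt_le {r : ℕ} {u : ℝ} (hu : 0 ≤ u) (hu1 : u ≤ 1)
    (hur : u ≤ incProb n r) (hup : ∀ i, 1 ≤ i → i < r → u < incProb n i) (k : ℕ) :
    P {ω | stackedRank S (fun i => X i ω) k < r} ≤
      ENNReal.ofReal ((1 - u) ^ k * tailPotential n r u S.rank) := by
  classical
  have hind : ∀ j, ∫ ω, tailPotential n r u (stackedRank S (fun i => X i ω) j) ∂P ≤
      (1 - u) ^ j * tailPotential n r u S.rank := fun j => by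
    induction j with
    | zero => simp [stackedRank_zero]
    | succ j ih =>
      have h := integral_stackedRank_succ_le hn S P X hX hlaw hindep (tailPotential n r u)
        (fun d => (1 - u) * tailPotential n r u d) (tailPotential_antitone hu hup)
        (fun d _ => by rw [incProb_succ]; exact tailPotential_step hu hur hup d) j
      rw [integral_const_mul] at h
      refine h.trans ?_
      rw [pow_succ', mul_assoc]
      exact mul_le_mul_of_nonneg_left ih (by linarith)
  have hmeas : MeasurableSet {ω | stackedRank S (fun i => X i ω) k < r} :=
    measurable_stackedRank S X hX k (measurableSet_Iio (a := r))
  rw [← lintegral_indicator_one hmeas]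
  simp only [Set.indicator_apply, Set.mem_ofPred_eq, Pi.one_apply]
  rw [lintegral_ite_stackedRank_lt S P X hX]
  refine ENNReal.ofReal_le_ofReal ((integral_mono
    (integrable_comp_stackedRank S P X hX k fun d => if d < r then 1 else 0)
    (integrable_comp_stackedRank S P X hX k _) fun ω => ?_).trans (hind k))
  dsimp only
  split_ifs with h
  · exact one_le_tailPotential hu hup h
  · exact (if_neg h).ge

-- Uses the rate `u = 1 / b`. Initial rank at least `1` forces `r ≥ 2`, hence `incProb n r < 1` and
-- `b > 1`.
include hX hlaw hindep in
theorem measure_rowsUntilRank_gt_le {r : ℕ} (hS : 1 ≤ S.rank) (hSr : S.rank < r) (hrn : r < n)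
    {x : ℝ} (hx : waitingSum n r S.rank ≤ x) :
    P {ω | ENNReal.ofReal x < (rowsUntilRank S r (fun i => X i ω) : ℝ≥0∞)} ≤
      ENNReal.ofReal (Real.exp (1 - x / waitingSum n r S.rank)) := by
  set b := waitingSum n r S.rank with hb
  have hq := incProb_pos hn (by omega : 1 ≤ r) hrn
  have hq1 := incProb_lt_one hn (by omega : 2 ≤ r)
  have hp : ∀ i ∈ Finset.Ico (S.rank + 1) r, incProb n r ≤ incProb n i := fun i hi => by
    rw [Finset.mem_Ico] at hi
    exact (incProb_strictAnti hn (by omega) hi.2).le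
  have hsum : 1 / incProb n r + ∑ i ∈ Finset.Ico (S.rank + 1) r, 1 / incProb n i = b := by
    rw [hb, waitingSum, add_comm, Finset.sum_Ico_add_eq_sum_Icc (by omega)]
  have hqb : 1 / incProb n r ≤ b := by
    rw [← hsum]
    exact le_add_of_nonneg_right (Finset.sum_nonneg fun i hi =>
      (one_div_pos.2 (hq.trans_le (hp i hi))).le)
  have hb1 : 1 < b := lt_of_lt_of_le ((one_lt_div hq).2 hq1) hqb
  have hb0 : 0 < b := by linarith
  have hu : 1 / b ≤ incProb n r := by
    rw [div_le_iff₀ hb0, mul_comm, ← div_le_iff₀ hq]; exact hqb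
  have hup : ∀ i, 1 ≤ i → i < r → 1 / b < incProb n i := fun i hi hir =>
    hu.trans_lt (incProb_strictAnti hn hi hir)
  have hx0 : 0 ≤ x := by linarith
  -- More than `x` rows means rank still below `r` after `⌊x⌋₊` rows.
  have hsub : {ω | ENNReal.ofReal x < (rowsUntilRank S r (fun i => X i ω) : ℝ≥0∞)} ⊆
      {ω | stackedRank S (fun i => X i ω) ⌊x⌋₊ < r} := fun ω h => by
    by_contra hr
    refine not_le_of_gt (show ENNReal.ofReal x < (rowsUntilRank S r (fun i => X i ω) : ℝ≥0∞) from h) ?_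
    have h1 : (rowsUntilRank S r (fun i => X i ω) : ℝ≥0∞) ≤ (⌊x⌋₊ : ℝ≥0∞) := by
      exact_mod_cast rowsUntilRank_le S (fun i => X i ω) hSr.le (not_lt.1 hr)
    refine h1.trans ?_
    rw [← ENNReal.ofReal_natCast]
    exact ENNReal.ofReal_le_ofReal (Nat.floor_le hx0)
  refine (measure_mono hsub).trans ((measure_stackedRank_lt_le hn S P X hX hlaw hindep
    (by positivity) (hu.trans hq1.le) hu hup ⌊x⌋₊).trans (ENNReal.ofReal_le_ofReal ?_))
  rw [tailPotential, if_pos hSr]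
  exact one_sub_inv_pow_mul_prod_le_exp _ _ hq hq1.le hp hsum hb1 hx
    (Nat.lt_floor_add_one x).le

end RankProcess

theorem mainTheorem3 {m n : ℕ} (hn : 2 ≤ n)
    (S₀ : Matrix (Fin m) (Fin n) ℝ) (hS₀ : IsSelectionMatrix S₀)
    (r₀ r : ℕ) (hrank : S₀.rank = r₀) (hr₀ : 1 ≤ r₀) (hr₀' : r₀ ≤ min m (n - 2))
    (hr : r₀ < r) (hrn : r ≤ n - 1)
    {Ω : Type*} [MeasurableSpace Ω] (P : Measure Ω) [IsProbabilityMeasure P]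
    (X : ℕ → Ω → Fin n × Fin n) (hX : ∀ i, Measurable (X i))
    (hlaw : ∀ i, P.map (X i) = (randomPair n hn).toMeasure)
    (hindep : iIndepFun X P) :
    (∀ δ : ℝ, 0 < δ → δ < 1 →
      P {ω | ENNReal.ofReal ((1 + Real.log (1 / δ)) *
              ∑ i ∈ Finset.Icc (r₀ + 1) r,
                1 / (1 - ((i : ℝ) * ((i : ℝ) - 1)) / ((n : ℝ) * ((n : ℝ) - 1))))
            < (rowsUntilRank S₀ r (fun i => X i ω) : ℝ≥0∞)}
        ≤ ENNReal.ofReal δ) ∧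
    ∫⁻ ω, (rowsUntilRank S₀ r (fun i => X i ω) : ℝ≥0∞) ∂P
      ≤ ENNReal.ofReal (∑ i ∈ Finset.Icc (r₀ + 1) r,
          1 / (1 - ((i : ℝ) * ((i : ℝ) - 1)) / ((n : ℝ) * ((n : ℝ) - 1)))) := by
  subst hrank
  have hrn' : r < n := by omega
  have hb : 0 ≤ waitingSum n r S₀.rank := waitingSum_nonneg hn hrn' _
  refine ⟨fun δ hδ hδ1 => ?_,
    lintegral_rowsUntilRank_le hn S₀ P X hX hlaw hindep hr.le hrn'⟩
  have hlog : 0 < Real.log (1 / δ) := Real.log_pos ((one_lt_div hδ).2 hδ1)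
  have h := measure_rowsUntilRank_gt_le hn S₀ P X hX hlaw hindep hr₀ hr hrn'
    (x := (1 + Real.log (1 / δ)) * waitingSum n r S₀.rank) (by nlinarith)
  refine h.trans (ENNReal.ofReal_le_ofReal ?_)
  have hb0 : waitingSum n r S₀.rank ≠ 0 := by
    rw [waitingSum_of_lt n hr]
    have h1 := waitingSum_nonneg hn hrn' (S₀.rank + 1)
    have h2 := one_div_pos.2 (incProb_pos hn (by omega : 1 ≤ S₀.rank + 1) (by omega))
    positivity
  rw [mul_div_cancel_right₀ _ hb0, Real.log_div one_ne_zero hδ.ne', Real.log_one,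
    show 1 - (1 + (0 - Real.log δ)) = Real.log δ by ring, Real.exp_log hδ]
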